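/- All graphs are finite and simple. In a burning process on a connected graph $G$, all vertices are initially unburned. In each round $r\ge 1$ one chooses a vertex $x_r$ that is unburned at the start of the round (the source of round $r$), and burns $x_r$ together with all neighbors of the vertices that were burned before round $r$; burned vertices remain burned. The process terminates when all vertices are burned; if it terminates in $k$ rounds, then $(x_1,\dots,x_k)$ is a burning sequence for $G$ of length $k$. The burning number $b(G)$ is the minimum length of a burning sequence for $G$. A full binary tree is a rooted tree in which every vertex has either $0$ or $2$ children. **Theorem.** Let $T$ be a full binary tree of order $n$ (that is, with $n$ vertices). Then $$b(T)\le \left\lceil \sqrt{n}\,\right\rceil.$$ -/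

import Mathlib

namespace GraphBurning

variable {V : Type*}

/-- The set of vertices that are burned at the end of round `r`, when `x 0, …, x (k - 1)` are the
sources of the rounds `1, …, k` (so the source of round `r + 1` is `x r`). Nothing is burned at the
start; in each round the source of that round burns, together with all the neighbors of the
vertices that were burned before that round; a burned vertex remains burned. -/
def burned (G : SimpleGraph V) {k : ℕ} (x : Fin k → V) : ℕ → Set V
  | 0 => ∅
  | r + 1 => burned G x r ∪ {v | ∃ u ∈ burned G x r, G.Adj u v} ∪ {v | ∃ h : r < k, v = x ⟨r, h⟩}

/-- `x` is a burning sequence for `G` of length `k`: each source is unburned when it is chosen, and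
after `k` rounds all the vertices are burned. As the last source is unburned before round `k`, the
process does not terminate before round `k`. -/
def IsBurningSequence (G : SimpleGraph V) {k : ℕ} (x : Fin k → V) : Prop :=
  (∀ i : Fin k, x i ∉ burned G x i) ∧ burned G x k = Set.univ

/-- The burning number: the minimum length of a burning sequence. For finite graphs the set of
lengths is nonempty, see `exists_isBurningSequence`. -/
noncomputable def burningNumber (G : SimpleGraph V) : ℕ :=
  sInf {k : ℕ | ∃ x : Fin k → V, IsBurningSequence G x}

/-- The children of `v` in the tree `T` rooted at `root`: the neighbors of `v` that are one step
further away from the root. -/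
def children (T : SimpleGraph V) (root v : V) : Set V :=
  {w | T.Adj v w ∧ T.dist root w = T.dist root v + 1}

/-- A full binary tree: a tree with a root, with respect to which every vertex has either no
children or exactly two children. -/
def IsFullBinaryTree (T : SimpleGraph V) : Prop :=
  T.IsTree ∧ ∃ root : V, ∀ v : V, (children T root v).encard = 0 ∨ (children T root v).encard = 2

theorem burned_subset_succ (G : SimpleGraph V) {k : ℕ} (x : Fin k → V) (r : ℕ) :
    burned G x r ⊆ burned G x (r + 1) :=
  fun _ hv => Or.inl (Or.inl hv)

theorem burned_snoc (G : SimpleGraph V) {k : ℕ} (x : Fin k → V) (y : V) (r : ℕ) (hr : r ≤ k) :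
    burned G (Fin.snoc x y : Fin (k + 1) → V) r = burned G x r := by
  induction r with
  | zero => rfl
  | succ r ih =>
    have hrk : r < k := hr
    have hsn : (Fin.snoc x y : Fin (k + 1) → V) ⟨r, by omega⟩ = x ⟨r, hrk⟩ :=
      Fin.snoc_castSucc (α := fun _ => V) y x ⟨r, hrk⟩
    have hs : {v | ∃ h : r < k + 1, v = (Fin.snoc x y : Fin (k + 1) → V) ⟨r, h⟩} =
        {v | ∃ h : r < k, v = x ⟨r, h⟩} := by
      ext v
      constructor
      · rintro ⟨_, h⟩
        exact ⟨hrk, h.trans hsn⟩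
      · rintro ⟨_, h⟩
        exact ⟨by omega, h.trans hsn.symm⟩
    simp only [burned, ih (by omega), hs]

/-- Every finite graph has a burning sequence. -/
theorem exists_isBurningSequence [Finite V] (G : SimpleGraph V) :
    {k : ℕ | ∃ x : Fin k → V, IsBurningSequence G x}.Nonempty := by
  by_contra hne
  have key : ∀ k : ℕ, ∃ x : Fin k → V, ∀ i : Fin k, x i ∉ burned G x i := by
    intro k
    induction k with
    | zero => exact ⟨Fin.elim0, fun i => i.elim0⟩
    | succ k ih =>
      obtain ⟨x, hx⟩ := ih
      have hu : burned G x k ≠ Set.univ := fun h => hne ⟨k, x, hx, h⟩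
      obtain ⟨y, hy⟩ := (Set.ne_univ_iff_exists_notMem _).1 hu
      refine ⟨Fin.snoc x y, fun i => ?_⟩
      rw [burned_snoc G x y i (Nat.lt_succ_iff.1 i.2)]
      refine Fin.lastCases ?_ (fun j => ?_) i
      · simpa using hy
      · simpa using hx j
  obtain ⟨x, hx⟩ := key (Nat.card V + 1)
  have hmono : Monotone (burned G x) := monotone_nat_of_le_succ (burned_subset_succ G x)
  have hinj : Function.Injective x := by
    have hlt : ∀ i j : Fin (Nat.card V + 1), i < j → x i ≠ x j := by
      intro i j hij he
      apply hx j
      rw [← he]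
      exact hmono (Nat.succ_le_of_lt hij) (Or.inr ⟨i.2, rfl⟩)
    intro i j he
    rcases lt_trichotomy i j with h | h | h
    · exact absurd he (hlt i j h)
    · exact h
    · exact absurd he.symm (hlt j i h)
  have hc := Nat.card_le_card_of_injective x hinj
  simp at hc

end GraphBurning

/-!
It suffices to cover a tree of order `n` with `m` one-child vertices by balls of radii
`0, …, k - 1`, where `n + m ≤ k ^ 2`: the larger the radius, the earlier the center is burned.

The balls are found greedily, largest radius first. To make the induction work, let `S` be the set
of uncovered vertices, kept closed under ancestors, and give each vertex of `S` weight `1`, or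
weight `2` if it has exactly one child in `S` and all its descendants in `S` are at distance less
than `k`. If `S` has weight at most `(r + 1) ^ 2`, choose `v` of height exactly `r` in `S`, let `a`
be the topmost ancestor of `v` all of whose descendants in `S` are in the ball `B(v, r)`, and remove
the descendants of `a`. At least `2 * r + 1` of the removed weight is below `v`, as a vertex on the
way down to a deepest descendant has another child or weight `2`; at least `d(a, v)` is between `a`
and `v`. On the other hand, the weight increases only at ancestors of `a`, and only at those at
distance at most `d(a, v)` from `a`, because the parent of `a` still has a deep descendant, namely
one outside `B(v, r)`. So the weight drops by at least `2 * r + 1 = (r + 1) ^ 2 - r ^ 2`.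
-/

namespace GraphBurning

variable {V : Type*} {G T : SimpleGraph V} {root : V}

section Ancestors

/-- The reflexive ancestor relation of the graph `G` rooted at `root`: one reaches `x` from `a` by
passing repeatedly to a child. -/
def IsAncestor (G : SimpleGraph V) (root : V) : V → V → Prop :=
  Relation.ReflTransGen fun v c => c ∈ children G root v

theorem IsAncestor.refl (v : V) : IsAncestor G root v v := Relation.ReflTransGen.refl

theorem IsAncestor.trans {a b x : V} (hab : IsAncestor G root a b) (hbx : IsAncestor G root b x) :
    IsAncestor G root a x :=
  Relation.ReflTransGen.trans hab hbx

theorem isAncestor_of_mem_children {v c : V} (hc : c ∈ children G root v) :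
    IsAncestor G root v c :=
  Relation.ReflTransGen.single hc

theorem dist_eq_one_of_mem_children {v c : V} (hc : c ∈ children G root v) : G.dist v c = 1 :=
  SimpleGraph.dist_eq_one_iff_adj.2 hc.1

theorem IsAncestor.dist_root_add_dist (hG : G.Connected) {a x : V} (h : IsAncestor G root a x) :
    G.dist root a + G.dist a x = G.dist root x := by
  induction h with
  | refl => simp
  | @tail b c _ hc ih =>
    have hac : G.dist a c ≤ G.dist a b + G.dist b c := hG.dist_triangle
    have hrc : G.dist root c ≤ G.dist root a + G.dist a c := hG.dist_triangle
    have hbc := dist_eq_one_of_mem_children hc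
    have := hc.2
    omega

theorem IsAncestor.dist_add_dist (hG : G.Connected) {a b x : V} (hab : IsAncestor G root a b)
    (hbx : IsAncestor G root b x) : G.dist a b + G.dist b x = G.dist a x := by
  have hb := hab.dist_root_add_dist hG
  have hx := hbx.dist_root_add_dist hG
  have hax := (hab.trans hbx).dist_root_add_dist hG
  omega

theorem not_isAncestor_of_mem_children (hG : G.Connected) {v c : V}
    (hc : c ∈ children G root v) : ¬ IsAncestor G root c v := by
  intro h
  have := h.dist_root_add_dist hG
  have := hc.2
  omega

theorem not_isAncestor_sibling (hG : G.Connected) {v c e : V} (hc : c ∈ children G root v)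
    (he : e ∈ children G root v) (hne : e ≠ c) : ¬ IsAncestor G root c e := by
  intro h
  have hd := h.dist_root_add_dist hG
  rw [he.2, hc.2] at hd
  exact hne (hG.dist_eq_zero_iff.1 (by omega)).symm

theorem exists_mem_children (hG : G.Connected) {x : V} (hx : x ≠ root) :
    ∃ p, x ∈ children G root p := by
  obtain ⟨w, hw⟩ := hG.exists_walk_length_eq_dist x root
  cases w with
  | nil => exact absurd rfl hx
  | @cons _ p _ hadj q =>
    have hp := SimpleGraph.dist_le q
    have hx : G.dist root x ≤ G.dist root p + G.dist p x := hG.dist_triangle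
    have hpx := SimpleGraph.dist_eq_one_iff_adj.2 hadj.symm
    rw [SimpleGraph.dist_comm] at hp
    rw [SimpleGraph.Walk.length_cons, SimpleGraph.dist_comm] at hw
    exact ⟨p, hadj.symm, by omega⟩

theorem exists_isAncestor_dist_eq (hG : G.Connected) {x : V} {k : ℕ} (hk : k ≤ G.dist root x) :
    ∃ a, IsAncestor G root a x ∧ G.dist a x = k := by
  induction k with
  | zero => exact ⟨x, .refl x, SimpleGraph.dist_self⟩
  | succ k ih =>
    obtain ⟨a, hax, hk'⟩ := ih (by omega)
    obtain ⟨p, hp⟩ : ∃ p, a ∈ children G root p :=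
      exists_mem_children hG (by rintro rfl; omega)
    have hpa := isAncestor_of_mem_children hp
    refine ⟨p, hpa.trans hax, ?_⟩
    rw [← hpa.dist_add_dist hG hax, dist_eq_one_of_mem_children hp, hk', add_comm]

theorem eq_of_mem_children (hT : T.IsTree) {p q x : V} (hp : x ∈ children T root p)
    (hq : x ∈ children T root q) : p = q := by
  have isPath_concat {u : V} (hu : x ∈ children T root u) (w : T.Walk root u)
      (hw : w.length = T.dist root u) : (w.concat hu.1).IsPath :=
    SimpleGraph.Walk.isPath_of_length_eq_dist _ (by rw [SimpleGraph.Walk.length_concat, hw, hu.2])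
  obtain ⟨v, hv⟩ := hT.connected.exists_walk_length_eq_dist root p
  obtain ⟨w, hw⟩ := hT.connected.exists_walk_length_eq_dist root q
  have heq := (hT.existsUnique_path root x).unique (isPath_concat hp v hv) (isPath_concat hq w hw)
  simpa using congrArg SimpleGraph.Walk.penultimate heq

theorem IsAncestor.total (hT : T.IsTree) {a b x : V} (ha : IsAncestor T root a x)
    (hb : IsAncestor T root b x) : IsAncestor T root a b ∨ IsAncestor T root b a := by
  have parent_unique : Relator.RightUnique (Function.swap fun v c => c ∈ children T root v) :=
    fun _ _ _ => eq_of_mem_children hT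
  have h := Relation.ReflTransGen.total_of_right_unique parent_unique ha.swap hb.swap
  exact h.symm.imp Relation.reflTransGen_swap.1 Relation.reflTransGen_swap.1

theorem IsAncestor.eq_of_dist_eq (hT : T.IsTree) {a b x : V} (ha : IsAncestor T root a x)
    (hb : IsAncestor T root b x) (hd : T.dist a x = T.dist b x) : a = b := by
  rcases ha.total hT hb with h | h
  · have := h.dist_add_dist hT.connected hb
    exact hT.connected.dist_eq_zero_iff.1 (by omega)
  · have := h.dist_add_dist hT.connected ha
    exact (hT.connected.dist_eq_zero_iff.1 (by omega)).symm

theorem card_le_of_isAncestor (hT : T.IsTree) {B : Finset V} {a : V} {n : ℕ}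
    (hB : ∀ y ∈ B, IsAncestor T root y a) (hne : a ∉ B) (hn : ∀ y ∈ B, T.dist y a ≤ n) :
    B.card ≤ n := by
  have hmaps : ∀ y ∈ B, T.dist y a ∈ Finset.Icc 1 n := fun y hy =>
    Finset.mem_Icc.2 ⟨hT.connected.pos_dist_of_ne (ne_of_mem_of_not_mem hy hne), hn y hy⟩
  have hinj : Set.InjOn (fun y => T.dist y a) B := fun y hy z hz =>
    (hB y hy).eq_of_dist_eq hT (hB z hz)
  simpa using Finset.card_le_card_of_injOn _ hmaps hinj

end Ancestors

section Weights

variable {S : Finset V} {k : ℕ}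

/-- The set `S` contains all ancestors of its elements, that is, it is empty or a subtree
containing the root. -/
def IsAncestorClosed (G : SimpleGraph V) (root : V) (S : Finset V) : Prop :=
  ∀ x ∈ S, ∀ a, IsAncestor G root a x → a ∈ S

open Classical in
/-- The descendants of `v` in the set `S`, including `v` itself if it is in `S`. -/
noncomputable def descendantsIn (G : SimpleGraph V) (root : V) (S : Finset V) (v : V) : Finset V :=
  {x ∈ S | IsAncestor G root v x}

/-- All descendants of `a` in `S` are at distance less than `k` from `v`. For `v = a` this says that
`a` has height less than `k` in `S`. -/
def DescendantsInBall (G : SimpleGraph V) (root : V) (S : Finset V) (v : V) (k : ℕ) (a : V) :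
    Prop :=
  ∀ x ∈ S, IsAncestor G root a x → G.dist v x < k

/-- The vertex `v` has exactly one child in `S`, and its height in `S` is less than `k`. -/
def IsShallowUnary (G : SimpleGraph V) (root : V) (S : Finset V) (k : ℕ) (v : V) : Prop :=
  (↑S ∩ children G root v).encard = 1 ∧ DescendantsInBall G root S v k v

open Classical in
/-- The weight of a vertex `v` of the uncovered set `S` when the balls of radii less than `k` are
still available: shallow unary vertices count twice. -/
noncomputable def weight (G : SimpleGraph V) (root : V) (S : Finset V) (k : ℕ) (v : V) : ℕ :=
  1 + if IsShallowUnary G root S k v then 1 else 0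

theorem IsShallowUnary.mono {l : ℕ} {v : V} (hkl : k ≤ l) (h : IsShallowUnary G root S k v) :
    IsShallowUnary G root S l v :=
  ⟨h.1, fun x hx hvx => (h.2 x hx hvx).trans_le hkl⟩

theorem mem_descendantsIn {v x : V} :
    x ∈ descendantsIn G root S v ↔ x ∈ S ∧ IsAncestor G root v x := by
  simp [descendantsIn]

theorem one_le_weight (v : V) : 1 ≤ weight G root S k v := Nat.le_add_right _ _

theorem sum_add_sum_descendantsIn_le {v c : V} {A : Finset V} (hvc : IsAncestor G root v c)
    (hAv : A ⊆ descendantsIn G root S v) (hAc : ∀ x ∈ A, ¬ IsAncestor G root c x) (f : V → ℕ) :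
    ∑ x ∈ A, f x + ∑ x ∈ descendantsIn G root S c, f x ≤
      ∑ x ∈ descendantsIn G root S v, f x := by
  classical
  have hdisj : Disjoint A (descendantsIn G root S c) :=
    Finset.disjoint_left.2 fun x hx hcx => hAc x hx (mem_descendantsIn.1 hcx).2
  rw [← Finset.sum_union hdisj]
  refine Finset.sum_le_sum_of_subset (Finset.union_subset hAv fun x hx => ?_)
  obtain ⟨hxS, hcx⟩ := mem_descendantsIn.1 hx
  exact mem_descendantsIn.2 ⟨hxS, hvc.trans hcx⟩

theorem add_sum_descendantsIn_le (hG : G.Connected) {v c : V} (hv : v ∈ S)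
    (hc : c ∈ children G root v) (f : V → ℕ) :
    f v + ∑ x ∈ descendantsIn G root S c, f x ≤ ∑ x ∈ descendantsIn G root S v, f x := by
  rw [← Finset.sum_singleton f v]
  refine sum_add_sum_descendantsIn_le (isAncestor_of_mem_children hc) ?_ ?_ f
  · exact Finset.singleton_subset_iff.2 (mem_descendantsIn.2 ⟨hv, .refl v⟩)
  · intro x hx
    rw [Finset.mem_singleton.1 hx]
    exact not_isAncestor_of_mem_children hG hc

theorem two_add_sum_weight_descendantsIn_le (hG : G.Connected) {v c : V} (hv : v ∈ S)
    (hcS : c ∈ S) (hc : c ∈ children G root v) (hheight : DescendantsInBall G root S v k v) :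
    2 + ∑ x ∈ descendantsIn G root S c, weight G root S k x ≤
      ∑ x ∈ descendantsIn G root S v, weight G root S k x := by
  classical
  by_cases hunary : (↑S ∩ children G root v).encard = 1
  · have hweight : weight G root S k v = 2 := by rw [weight, if_pos ⟨hunary, hheight⟩]
    rw [← hweight]
    exact add_sum_descendantsIn_le hG hv hc _
  · obtain ⟨e, ⟨heS, he⟩, hne⟩ : ∃ e ∈ ↑S ∩ children G root v, e ≠ c := by
      by_contra! h
      exact hunary (Set.encard_eq_one.2
        ⟨c, Set.eq_singleton_iff_unique_mem.2 ⟨⟨hcS, hc⟩, h⟩⟩)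
    have hve : v ≠ e := he.1.ne
    have hpair : 2 ≤ ∑ x ∈ {v, e}, weight G root S k x := by
      rw [Finset.sum_pair hve]
      exact Nat.add_le_add (one_le_weight v) (one_le_weight e)
    refine (Nat.add_le_add_right hpair _).trans
      (sum_add_sum_descendantsIn_le (isAncestor_of_mem_children hc) ?_ ?_ _)
    · simp only [Finset.insert_subset_iff, Finset.singleton_subset_iff, mem_descendantsIn]
      exact ⟨⟨hv, .refl v⟩, heS, isAncestor_of_mem_children he⟩
    · simp only [Finset.mem_insert, Finset.mem_singleton, forall_eq_or_imp, forall_eq]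
      exact ⟨not_isAncestor_of_mem_children hG hc, not_isAncestor_sibling hG hc he hne⟩

theorem DescendantsInBall.of_mem_children (hG : G.Connected) {v c : V}
    (hc : c ∈ children G root v) (h : DescendantsInBall G root S v k v) :
    DescendantsInBall G root S c k c := by
  intro x hx hcx
  have hvc := isAncestor_of_mem_children hc
  have := hvc.dist_add_dist hG hcx
  have := h x hx (hvc.trans hcx)
  omega

theorem two_mul_dist_add_one_le_sum_weight (hG : G.Connected) (hS : IsAncestorClosed G root S)
    {v x : V} (hx : x ∈ S) (hvx : IsAncestor G root v x)
    (hheight : DescendantsInBall G root S v k v) :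
    2 * G.dist v x + 1 ≤ ∑ y ∈ descendantsIn G root S v, weight G root S k y := by
  induction hvx using Relation.ReflTransGen.head_induction_on with
  | refl =>
    have hmem : x ∈ descendantsIn G root S x := mem_descendantsIn.2 ⟨hx, .refl x⟩
    rw [SimpleGraph.dist_self]
    exact (one_le_weight x).trans (Finset.single_le_sum (fun _ _ => Nat.zero_le _) hmem)
  | @head v c hc hcx ih =>
    have hvc := isAncestor_of_mem_children hc
    have hdist := hvc.dist_add_dist hG hcx
    have hstep := two_add_sum_weight_descendantsIn_le hG (hS x hx v (hvc.trans hcx))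
      (hS x hx c hcx) hc hheight
    have := ih (hheight.of_mem_children hG hc)
    have := dist_eq_one_of_mem_children hc
    omega

theorem dist_add_sum_weight_descendantsIn_le (hG : G.Connected) (hS : IsAncestorClosed G root S)
    {a v : V} (hv : v ∈ S) (hav : IsAncestor G root a v) :
    G.dist a v + ∑ x ∈ descendantsIn G root S v, weight G root S k x ≤
      ∑ x ∈ descendantsIn G root S a, weight G root S k x := by
  induction hav using Relation.ReflTransGen.head_induction_on with
  | refl => simp
  | @head a c hc hcv ih =>
    have hac := isAncestor_of_mem_children hc
    have hdist := hac.dist_add_dist hG hcv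
    have hstep := add_sum_descendantsIn_le hG (hS v hv a (hac.trans hcv)) hc (weight G root S k)
    have := one_le_weight (G := G) (root := root) (S := S) (k := k) a
    have := dist_eq_one_of_mem_children hc
    omega

end Weights

section Removal

variable {S : Finset V} {k r : ℕ} {a v y : V}

theorem exists_isAncestor_dist_eq_descendantsInBall (hG : G.Connected)
    (hS : ∃ x ∈ S, r ≤ G.dist root x) :
    ∃ v, ∃ x ∈ S, IsAncestor G root v x ∧ G.dist v x = r ∧
      DescendantsInBall G root S v (r + 1) v := by
  obtain ⟨z, hz, hrz⟩ := hS
  obtain ⟨x, hx, hdeepest⟩ := S.exists_max_image (G.dist root) ⟨z, hz⟩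
  obtain ⟨v, hvx, hd⟩ := exists_isAncestor_dist_eq hG (hrz.trans (hdeepest z hz))
  refine ⟨v, x, hx, hvx, hd, fun y hy hvy => ?_⟩
  have := hdeepest y hy
  have := hvx.dist_root_add_dist hG
  have := hvy.dist_root_add_dist hG
  omega

theorem exists_topmost_isAncestor {P : V → Prop} (hv : P v) :
    ∃ a, IsAncestor G root a v ∧ P a ∧ ∀ b, a ∈ children G root b → ¬ P b := by
  obtain ⟨a, ⟨hav, ha⟩, hmin⟩ := exists_minimalFor_of_wellFoundedLT
    (fun a => IsAncestor G root a v ∧ P a) (G.dist root) ⟨v, .refl v, hv⟩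
  refine ⟨a, hav, ha, fun b hab hb => ?_⟩
  have := hab.2
  have := hmin ⟨(isAncestor_of_mem_children hab).trans hav, hb⟩ (by omega)
  omega

variable [DecidableEq V]

theorem mem_sdiff_descendantsIn {x : V} :
    x ∈ S \ descendantsIn G root S a ↔ x ∈ S ∧ ¬ IsAncestor G root a x := by
  rw [Finset.mem_sdiff, mem_descendantsIn]
  tauto

theorem IsAncestorClosed.sdiff_descendantsIn (hS : IsAncestorClosed G root S) :
    IsAncestorClosed G root (S \ descendantsIn G root S a) := by
  intro x hx z hzx
  obtain ⟨hxS, hax⟩ := mem_sdiff_descendantsIn.1 hx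
  exact mem_sdiff_descendantsIn.2 ⟨hS x hxS z hzx, fun haz => hax (haz.trans hzx)⟩

theorem IsShallowUnary.of_sdiff_descendantsIn (hT : T.IsTree) (hay : ¬ IsAncestor T root a y)
    (hya : ¬ IsAncestor T root y a)
    (h : IsShallowUnary T root (S \ descendantsIn T root S a) k y) :
    IsShallowUnary T root S k y := by
  have hmem (x : V) (hyx : IsAncestor T root y x) :
      x ∈ S \ descendantsIn T root S a ↔ x ∈ S := by
    rw [mem_sdiff_descendantsIn, and_iff_left]
    exact fun hax => (hax.total hT hyx).elim hay hya
  have hchildren : (↑(S \ descendantsIn T root S a) ∩ children T root y : Set V) =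
      ↑S ∩ children T root y := by
    ext c
    exact and_congr_left fun hc => hmem c (isAncestor_of_mem_children hc)
  exact ⟨hchildren ▸ h.1, fun x hx hyx => h.2 x ((hmem x hyx).2 hx) hyx⟩

theorem dist_le_of_descendantsInBall_sdiff (hG : G.Connected) (hav : IsAncestor G root a v)
    (ha : DescendantsInBall G root S v (r + 1) a)
    (htop : ∀ b, a ∈ children G root b → ¬ DescendantsInBall G root S v (r + 1) b)
    (hya : IsAncestor G root y a) (hne : y ≠ a)
    (hy : DescendantsInBall G root (S \ descendantsIn G root S a) y r y) :
    G.dist y a ≤ G.dist a v := by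
  obtain rfl | ⟨b, hyb, hab⟩ := Relation.ReflTransGen.cases_tail hya
  · exact absurd rfl hne
  obtain ⟨x, hx, hbx, hfar⟩ : ∃ x ∈ S, IsAncestor G root b x ∧ r + 1 ≤ G.dist v x := by
    simpa only [DescendantsInBall, not_forall, not_lt, exists_prop] using htop b hab
  have hax : ¬ IsAncestor G root a x := fun hax => (ha x hx hax).not_ge hfar
  have hnear : G.dist y x < r := hy x (mem_sdiff_descendantsIn.2 ⟨hx, hax⟩) (hyb.trans hbx)
  have hdist_yx := IsAncestor.dist_add_dist hG hyb hbx
  have hdist_ya := IsAncestor.dist_add_dist hG hyb (isAncestor_of_mem_children hab)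
  have hdist_bv := (isAncestor_of_mem_children hab).dist_add_dist hG hav
  have hdist_vx : G.dist v x ≤ G.dist v b + G.dist b x := hG.dist_triangle
  rw [SimpleGraph.dist_comm (u := v) (v := b)] at hdist_vx
  rw [dist_eq_one_of_mem_children hab] at hdist_ya hdist_bv
  omega

theorem sum_weight_sdiff_descendantsIn_le (hT : T.IsTree) (hav : IsAncestor T root a v)
    (ha : DescendantsInBall T root S v (r + 1) a)
    (htop : ∀ b, a ∈ children T root b → ¬ DescendantsInBall T root S v (r + 1) b) :
    ∑ y ∈ S \ descendantsIn T root S a, weight T root (S \ descendantsIn T root S a) r y ≤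
      ∑ y ∈ S \ descendantsIn T root S a, weight T root S (r + 1) y + T.dist a v := by
  classical
  set S' := S \ descendantsIn T root S a
  have not_isAncestor {y : V} (hy : y ∈ S') : ¬ IsAncestor T root a y :=
    (mem_sdiff_descendantsIn.1 hy).2
  set B := {y ∈ S' | IsAncestor T root y a ∧ IsShallowUnary T root S' r y}
  have hBcard : B.card ≤ T.dist a v := by
    have haB : a ∉ B := fun h => not_isAncestor (Finset.mem_of_mem_filter _ h) (.refl a)
    refine card_le_of_isAncestor hT (fun y hy => (Finset.mem_filter.1 hy).2.1) haB fun y hy => ?_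
    obtain ⟨-, hya, hunary⟩ := Finset.mem_filter.1 hy
    exact dist_le_of_descendantsInBall_sdiff hT.connected hav ha htop hya
      (ne_of_mem_of_not_mem hy haB) hunary.2
  have hweight : ∀ y ∈ S', weight T root S' r y ≤
      weight T root S (r + 1) y +
        if IsAncestor T root y a ∧ IsShallowUnary T root S' r y then 1 else 0 := by
    intro y hy
    have : IsShallowUnary T root S' r y → ¬ IsAncestor T root y a →
        IsShallowUnary T root S (r + 1) y := fun h hya =>
      (h.of_sdiff_descendantsIn hT (not_isAncestor hy) hya).mono r.le_succ
    unfold weight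
    split_ifs <;> grind
  refine (Finset.sum_le_sum hweight).trans ?_
  rw [Finset.sum_add_distrib, ← Finset.card_filter]
  exact Nat.add_le_add_left hBcard _

theorem exists_sum_weight_sdiff_descendantsIn_add_le (hT : T.IsTree)
    (hS : IsAncestorClosed T root S) (hdeep : ∃ x ∈ S, r ≤ T.dist root x) :
    ∃ v a, DescendantsInBall T root S v (r + 1) a ∧
      ∑ x ∈ S \ descendantsIn T root S a, weight T root (S \ descendantsIn T root S a) r x +
        (2 * r + 1) ≤ ∑ x ∈ S, weight T root S (r + 1) x := by
  obtain ⟨v, x, hx, hvx, hd, hv⟩ := exists_isAncestor_dist_eq_descendantsInBall hT.connected hdeep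
  obtain ⟨a, hav, ha, htop⟩ := exists_topmost_isAncestor (G := T) (root := root) hv
  refine ⟨v, a, ha, ?_⟩
  have hbelow := two_mul_dist_add_one_le_sum_weight hT.connected hS hx hvx hv
  have hbetween := dist_add_sum_weight_descendantsIn_le (k := r + 1) hT.connected hS
    (hS x hx v hvx) hav
  have hremaining := sum_weight_sdiff_descendantsIn_le hT hav ha htop
  have hsplit : ∑ y ∈ S \ descendantsIn T root S a, weight T root S (r + 1) y +
      ∑ y ∈ descendantsIn T root S a, weight T root S (r + 1) y =
        ∑ y ∈ S, weight T root S (r + 1) y :=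
    Finset.sum_sdiff fun y hy => (mem_descendantsIn.1 hy).1
  rw [hd] at hbelow
  omega

end Removal

theorem exists_cover_of_sum_weight_le_sq (hT : T.IsTree) {S : Finset V} {k : ℕ}
    (hS : IsAncestorClosed T root S) (hweight : ∑ x ∈ S, weight T root S k x ≤ k ^ 2) :
    ∃ c : ℕ → V, ∀ x ∈ S, ∃ i < k, T.dist (c i) x ≤ i := by
  classical
  induction k generalizing S with
  | zero =>
    refine ⟨fun _ => root, fun x hx => ?_⟩
    have hle := Finset.single_le_sum (fun _ _ => Nat.zero_le _) hx |>.trans hweight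
    have := one_le_weight (G := T) (root := root) (S := S) (k := 0) x
    omega
  | succ r ih =>
    by_cases hdeep : ∃ x ∈ S, r ≤ T.dist root x
    · obtain ⟨v, a, ha, hdrop⟩ := exists_sum_weight_sdiff_descendantsIn_add_le hT hS hdeep
      obtain ⟨c, hc⟩ := ih (S := S \ descendantsIn T root S a) hS.sdiff_descendantsIn (by nlinarith)
      refine ⟨Function.update c r v, fun x hx => ?_⟩
      by_cases hax : IsAncestor T root a x
      · exact ⟨r, r.lt_succ_self, by simpa using Nat.le_of_lt_succ (ha x hx hax)⟩
      · obtain ⟨i, hi, hdist⟩ := hc x (mem_sdiff_descendantsIn.2 ⟨hx, hax⟩)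
        exact ⟨i, hi.trans r.lt_succ_self, by rwa [Function.update_of_ne hi.ne]⟩
    · push Not at hdeep
      exact ⟨fun _ => root, fun x hx => ⟨r, r.lt_succ_self, (hdeep x hx).le⟩⟩

section Burning

theorem mem_burned_add_length {k : ℕ} (x : Fin k → V) {u w : V} (p : G.Walk u w) {i : ℕ}
    (hu : u ∈ burned G x i) : w ∈ burned G x (i + p.length) := by
  induction p generalizing i with
  | nil => exact hu
  | cons hadj q ih =>
    have := ih (i := i + 1) (Or.inl (Or.inr ⟨_, hu, hadj⟩))
    rwa [SimpleGraph.Walk.length_cons, add_comm q.length, ← add_assoc]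

theorem snoc_notMem_burned {m : ℕ} {x : Fin m → V} {y : V} (hx : ∀ i : Fin m, x i ∉ burned G x i)
    (hy : y ∉ burned G x m) (i : Fin (m + 1)) :
    (Fin.snoc x y : Fin (m + 1) → V) i ∉ burned G (Fin.snoc x y : Fin (m + 1) → V) i := by
  rw [burned_snoc G x y i (Nat.lt_succ_iff.1 i.2)]
  induction i using Fin.lastCases with
  | last => simpa using hy
  | cast i => simpa using hx i

theorem exists_sources_of_le_burningNumber (c : ℕ → V) {m : ℕ} (hm : m ≤ burningNumber G) :
    ∃ x : Fin m → V, (∀ i : Fin m, x i ∉ burned G x i) ∧ ∀ i < m, c i ∈ burned G x (i + 1) := by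
  induction m with
  | zero => exact ⟨Fin.elim0, fun i => i.elim0, fun i hi => absurd hi (Nat.not_lt_zero i)⟩
  | succ m ih =>
    obtain ⟨x, hx, hc⟩ := ih (by omega)
    have hunburned : burned G x m ≠ Set.univ := fun h =>
      Nat.notMem_of_lt_sInf hm ⟨x, hx, h⟩
    -- If the prescribed center is already burned, any unburned vertex will do as a source.
    obtain ⟨y, hy, hcy⟩ : ∃ y, y ∉ burned G x m ∧ (c m ∈ burned G x m ∨ y = c m) := by
      by_cases hcm : c m ∈ burned G x m
      · obtain ⟨y, hy⟩ := (Set.ne_univ_iff_exists_notMem _).1 hunburned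
        exact ⟨y, hy, Or.inl hcm⟩
      · exact ⟨c m, hcm, Or.inr rfl⟩
    refine ⟨Fin.snoc x y, snoc_notMem_burned hx hy, fun i hi => ?_⟩
    rcases Nat.lt_succ_iff_lt_or_eq.1 hi with hi | rfl
    · rw [burned_snoc G x y _ hi]
      exact hc i hi
    · rcases hcy with hci | rfl
      · exact burned_subset_succ _ _ _ (by rwa [burned_snoc G x y i le_rfl])
      · exact Or.inr ⟨i.lt_succ_self, (Fin.snoc_last (α := fun _ => V) (c i) x).symm⟩

theorem burningNumber_le_of_cover (hG : G.Connected) {k : ℕ} (c : ℕ → V)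
    (hc : ∀ x, ∃ i < k, G.dist (c i) x ≤ i) : burningNumber G ≤ k := by
  by_contra! hk
  obtain ⟨x, hx, hburned⟩ := exists_sources_of_le_burningNumber (fun i => c (k - 1 - i)) hk.le
  refine Nat.notMem_of_lt_sInf hk ⟨x, hx, Set.eq_univ_of_forall fun w => ?_⟩
  obtain ⟨i, hi, hd⟩ := hc w
  obtain ⟨p, hp⟩ := hG.exists_walk_length_eq_dist (c i) w
  have hci : c i ∈ burned G x (k - 1 - i + 1) := by
    simpa only [Nat.sub_sub_self (Nat.le_sub_one_of_lt hi)] using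
      hburned (k - 1 - i) (by omega)
  exact monotone_nat_of_le_succ (burned_subset_succ G x) (by omega) (mem_burned_add_length x p hci)

end Burning

theorem sum_weight_univ_le [Fintype V] (k : ℕ) :
    ∑ x, weight G root Finset.univ k x ≤
      Fintype.card V + {v | (children G root v).encard = 1}.ncard := by
  classical
  have hunary (v : V) : IsShallowUnary G root Finset.univ k v → (children G root v).encard = 1 :=
    fun h => by simpa using h.1
  have hcard : (Finset.univ.filter (IsShallowUnary G root Finset.univ k)).card ≤
      {v | (children G root v).encard = 1}.ncard := by
    rw [← Set.ncard_coe_finset]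
    exact Set.ncard_le_ncard (fun v hv => hunary v (by simpa using hv)) (Set.toFinite _)
  simp only [weight, Finset.sum_add_distrib, Finset.sum_const, smul_eq_mul, mul_one,
    ← Finset.card_filter, Finset.card_univ]
  exact Nat.add_le_add_left hcard _

end GraphBurning

open GraphBurning in
theorem mainTheorem4_general {V : Type*} [Fintype V] {T : SimpleGraph V} (hT : T.IsTree)
    (root : V) :
    burningNumber T ≤
      ⌈√(Fintype.card V + {v | (children T root v).encard = 1}.ncard : ℝ)⌉₊ := by
  set k := ⌈√(Fintype.card V + {v | (children T root v).encard = 1}.ncard : ℝ)⌉₊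
  have hsq : Fintype.card V + {v | (children T root v).encard = 1}.ncard ≤ k ^ 2 := by
    exact_mod_cast (Real.sqrt_le_left k.cast_nonneg).1 (Nat.le_ceil _)
  obtain ⟨c, hc⟩ := exists_cover_of_sum_weight_le_sq hT (S := Finset.univ) (root := root)
    (fun _ _ a _ => Finset.mem_univ a) ((sum_weight_univ_le k).trans hsq)
  exact burningNumber_le_of_cover hT.connected c fun x => hc x (Finset.mem_univ x)

theorem mainTheorem4 {V : Type*} [Fintype V] (T : SimpleGraph V)
    (hT : GraphBurning.IsFullBinaryTree T) :
    GraphBurning.burningNumber T ≤ ⌈Real.sqrt (Fintype.card V : ℝ)⌉₊ := by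
  obtain ⟨hT, root, hchildren⟩ := hT
  have hunary (v : V) : (GraphBurning.children T root v).encard ≠ 1 := by
    rcases hchildren v with h | h <;> simp [h]
  simpa [hunary] using mainTheorem4_general hT root
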